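/- Let $n\ge 2$. Let $\mathcal T_n=\{A\in M_n(\mathbb C): A_{ij}=0 \text{ whenever } |i-j|\ge 2\}$ be the operator system of tridiagonal matrices. Let $C^*(\mathbb F_{n-1})$ be the full group C$^*$-algebra of the free group on $n-1$ generators, let $u_1,\dots,u_{n-1}\in C^*(\mathbb F_{n-1})$ be the universal unitaries corresponding to the free generators, and let $$\mathcal S_{n-1}=\operatorname{Span}\{1,u_j,u_j^*: 1\le j\le n-1\}\subseteq C^*(\mathbb F_{n-1}).$$ Let $\mathcal V_n,\mathcal U_n\subseteq\bigoplus_{k=1}^{n-1}M_2(\mathbb C)$ be the operator subsystems $$\mathcal V_n=\Big\{\bigoplus_{k=1}^{n-1}\begin{bmatrix}a^k_{11}&a^k_{12}\\a^k_{21}&a^k_{22}\end{bmatrix}: a^k_{22}=a^{k+1}_{11}\ \text{ for all } 1\le k\le n-2\Big\},$$ $$\mathcal U_n=\Big\{\bigoplus_{k=1}^{n-1}\begin{bmatrix}a^k_{11}&a^k_{12}\\a^k_{21}&a^k_{22}\end{bmatrix}: a^k_{ii}=a^\ell_{jj}\ \text{ for all } 1\le k,\ell\le n-1,\ i,j\in\{1,2\}\Big\}.$$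 For a finite-dimensional operator system $\mathcal S$, the dual $\mathcal S^d$ is the space of linear functionals on $\mathcal S$ with the involution $f^*(s)=\overline{f(s^*)}$ and the matrix ordering in which $G=[g_{ij}]\in M_p(\mathcal S^d)$ is positive if and only if the map $\hat G:\mathcal S\to M_p(\mathbb C)$, $\hat G(s)=[g_{ij}(s)]$, is completely positive. Two matricially ordered spaces are completely order isomorphic if there is a linear isomorphism $\phi$ between them such that $\phi$ and $\phi^{-1}$ are completely positive. Then: 1. $\mathcal T_n^d$ and $\mathcal V_n$ are completely order isomorphic; 2. $\mathcal S_{n-1}^d$ and $\mathcal U_n$ are completely order isomorphic. -/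

import Mathlib

open scoped Matrix ComplexOrder ENNReal

noncomputable section

namespace OpSys

/-! ### Matricially ordered spaces and operator systems -/

/-- The compression `αᴴ X α` of a matrix `X` over a complex vector space by a scalar matrix `α`. -/
def compress {V : Type*} [AddCommGroup V] [Module ℂ V] {p q : ℕ}
    (α : Matrix (Fin p) (Fin q) ℂ) (X : Matrix (Fin p) (Fin p) V) : Matrix (Fin q) (Fin q) V :=
  fun k l => ∑ i, ∑ j, (star (α i k) * α j l) • X i j

/-- The diagonal matrix over `V` with the vector `e` in every diagonal position. -/
def diagUnit {V : Type*} [AddCommGroup V] (p : ℕ) (e : V) : Matrix (Fin p) (Fin p) V :=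
  Matrix.diagonal fun _ => e

/-- A matricially ordered complex `*`-vector space: proper cones `pos p ⊆ M_p(V)_sa`, compatible
with compressions by scalar matrices (taking `α = √r` shows that each `pos p` is closed under
multiplication by nonnegative reals). -/
class MatrixOrderedSpace (V : Type*) [AddCommGroup V] [Module ℂ V] [StarAddMonoid V]
    [StarModule ℂ V] where
  pos : ∀ p : ℕ, Set (Matrix (Fin p) (Fin p) V)
  selfAdjoint_of_pos : ∀ {p : ℕ} {X : Matrix (Fin p) (Fin p) V}, X ∈ pos p → Xᴴ = X
  zero_pos : ∀ p : ℕ, (0 : Matrix (Fin p) (Fin p) V) ∈ pos p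
  add_pos : ∀ {p : ℕ} {X Y : Matrix (Fin p) (Fin p) V}, X ∈ pos p → Y ∈ pos p → X + Y ∈ pos p
  proper : ∀ {p : ℕ} {X : Matrix (Fin p) (Fin p) V}, X ∈ pos p → -X ∈ pos p → X = 0
  compress_pos : ∀ {p q : ℕ} (α : Matrix (Fin p) (Fin q) ℂ) {X : Matrix (Fin p) (Fin p) V},
    X ∈ pos p → compress α X ∈ pos q

/-- An (abstract) operator system: a matricially ordered `*`-vector space with an Archimedean
matrix order unit. -/
class OperatorSystem (V : Type*) [AddCommGroup V] [Module ℂ V] [StarAddMonoid V]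
    [StarModule ℂ V] extends MatrixOrderedSpace V where
  unit : V
  star_unit : star unit = unit
  order_unit : ∀ {p : ℕ} (X : Matrix (Fin p) (Fin p) V), Xᴴ = X →
    ∃ r : ℝ, 0 < r ∧ (r : ℂ) • diagUnit p unit + X ∈ pos p
  archimedean : ∀ {p : ℕ} (X : Matrix (Fin p) (Fin p) V),
    (∀ ε : ℝ, 0 < ε → (ε : ℂ) • diagUnit p unit + X ∈ pos p) → X ∈ pos p

/-- A linear map is completely positive if all its amplifications preserve the positive cones. -/
def IsCompletelyPositive {V W : Type*} [AddCommGroup V] [Module ℂ V] [StarAddMonoid V]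
    [StarModule ℂ V] [MatrixOrderedSpace V] [AddCommGroup W] [Module ℂ W] [StarAddMonoid W]
    [StarModule ℂ W] [MatrixOrderedSpace W] (φ : V →ₗ[ℂ] W) : Prop :=
  ∀ (p : ℕ) (X : Matrix (Fin p) (Fin p) V),
    X ∈ MatrixOrderedSpace.pos p → X.map φ ∈ MatrixOrderedSpace.pos p

/-- `V` and `W` are completely order isomorphic: there is a linear isomorphism `φ : V → W` such
that `φ` and `φ⁻¹` are completely positive. -/
def CompletelyOrderIsomorphic (V W : Type*) [AddCommGroup V] [Module ℂ V] [StarAddMonoid V]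
    [StarModule ℂ V] [MatrixOrderedSpace V] [AddCommGroup W] [Module ℂ W] [StarAddMonoid W]
    [StarModule ℂ W] [MatrixOrderedSpace W] : Prop :=
  ∃ φ : V ≃ₗ[ℂ] W,
    IsCompletelyPositive (φ : V →ₗ[ℂ] W) ∧ IsCompletelyPositive (φ.symm : W →ₗ[ℂ] V)

/-! ### Operator subsystems of unital C⋆-algebras -/

/-- An operator subsystem of a unital C⋆-algebra: a unital self-adjoint linear subspace. -/
structure OperatorSubsystem (A : Type*) [CStarAlgebra A] extends Submodule ℂ A where
  one_mem' : (1 : A) ∈ carrier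
  star_mem' : ∀ {a : A}, a ∈ carrier → star a ∈ carrier

/-- The positive cone of `M_p(A)` for a C⋆-algebra `A`: the matrices `Bᴴ B` with `B ∈ M_p(A)`. -/
def matrixPos (A : Type*) [CStarAlgebra A] (p : ℕ) : Set (Matrix (Fin p) (Fin p) A) :=
  {X | ∃ B : Matrix (Fin p) (Fin p) A, X = Bᴴ * B}

section MatrixPosFacts

theorem nonneg_iff_star_mul {B : Type*} [CStarAlgebra B] [PartialOrder B] [StarOrderedRing B]
    (x : B) : 0 ≤ x ↔ ∃ b, x = star b * b :=
  CStarAlgebra.nonneg_iff_eq_star_mul_self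

theorem exists_pos_shift_nonneg {B : Type*} [CStarAlgebra B] [PartialOrder B]
    [StarOrderedRing B] {x : B} (hx : IsSelfAdjoint x) :
    ∃ r : ℝ, 0 < r ∧ 0 ≤ (r : ℂ) • (1 : B) + x := by
  refine ⟨‖x‖ + 1, by positivity, ?_⟩
  have h1 := hx.neg_algebraMap_norm_le_self
  rw [Algebra.algebraMap_eq_smul_one, neg_le_iff_add_nonneg] at h1
  have h2 := add_nonneg h1 (zero_le_one (α := B))
  rw [Complex.coe_smul, add_smul, one_smul]
  convert h2 using 1
  abel

variable {A : Type*} [CStarAlgebra A]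

theorem mem_matrixPos_iff_nonneg {p : ℕ} (X : Matrix (Fin p) (Fin p) A) :
    letI : PartialOrder A := CStarAlgebra.spectralOrder A
    haveI : StarOrderedRing A := CStarAlgebra.spectralOrderedRing A
    X ∈ matrixPos A p ↔ 0 ≤ CStarMatrix.ofMatrix X := by
  let _ : PartialOrder A := CStarAlgebra.spectralOrder A
  have _ : StarOrderedRing A := CStarAlgebra.spectralOrderedRing A
  exact (nonneg_iff_star_mul (CStarMatrix.ofMatrix X)).symm

theorem matrixPos_selfAdjoint {p : ℕ} {X : Matrix (Fin p) (Fin p) A} (h : X ∈ matrixPos A p) :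
    Xᴴ = X := by
  obtain ⟨B, rfl⟩ := h
  simp

theorem matrixPos_zero (p : ℕ) : (0 : Matrix (Fin p) (Fin p) A) ∈ matrixPos A p :=
  ⟨0, by simp⟩

theorem matrixPos_add {p : ℕ} {X Y : Matrix (Fin p) (Fin p) A} (hX : X ∈ matrixPos A p)
    (hY : Y ∈ matrixPos A p) : X + Y ∈ matrixPos A p := by
  let _ : PartialOrder A := CStarAlgebra.spectralOrder A
  have _ : StarOrderedRing A := CStarAlgebra.spectralOrderedRing A
  have hX' := (mem_matrixPos_iff_nonneg X).1 hX
  have hY' := (mem_matrixPos_iff_nonneg Y).1 hY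
  exact (mem_matrixPos_iff_nonneg (X + Y)).2 (add_nonneg hX' hY')

theorem matrixPos_proper {p : ℕ} {X : Matrix (Fin p) (Fin p) A} (hX : X ∈ matrixPos A p)
    (hY : -X ∈ matrixPos A p) : X = 0 := by
  let _ : PartialOrder A := CStarAlgebra.spectralOrder A
  have _ : StarOrderedRing A := CStarAlgebra.spectralOrderedRing A
  have hX' : 0 ≤ CStarMatrix.ofMatrix X := (mem_matrixPos_iff_nonneg X).1 hX
  have hY' : 0 ≤ -CStarMatrix.ofMatrix X := (mem_matrixPos_iff_nonneg (-X)).1 hY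
  have h : CStarMatrix.ofMatrix X = 0 := le_antisymm (neg_nonneg.1 hY') hX'
  exact h

theorem matrixPos_conj {p q : ℕ} (C : Matrix (Fin p) (Fin q) A) :
    Cᴴ * C ∈ matrixPos A q := by
  classical
  rcases q with _ | q
  · exact ⟨0, by ext i; exact i.elim0⟩
  · have key : Cᴴ * C = ∑ k : Fin p,
        (Matrix.of fun (i : Fin (q + 1)) j => if i = 0 then C k j else 0)ᴴ *
        (Matrix.of fun (i : Fin (q + 1)) j => if i = 0 then C k j else 0) := by
      ext i j
      rw [Matrix.sum_apply]
      simp only [Matrix.mul_apply, Matrix.conjTranspose_apply, Matrix.of_apply]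
      refine Finset.sum_congr rfl fun k _ => ?_
      rw [Finset.sum_eq_single 0] <;> simp +contextual
    rw [key]
    refine Finset.sum_induction _ (· ∈ matrixPos A (q + 1)) (fun _ _ => matrixPos_add)
      (matrixPos_zero _) fun k _ => ⟨_, rfl⟩

theorem compress_eq_mul {p q : ℕ} (α : Matrix (Fin p) (Fin q) ℂ) (X : Matrix (Fin p) (Fin p) A) :
    compress α X = (α.map (algebraMap ℂ A))ᴴ * X * α.map (algebraMap ℂ A) := by
  ext k l
  simp only [compress, Matrix.mul_apply, Matrix.conjTranspose_apply, Matrix.map_apply,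
    Finset.sum_mul]
  rw [Finset.sum_comm]
  refine Finset.sum_congr rfl fun j _ => Finset.sum_congr rfl fun i _ => ?_
  rw [← algebraMap_star_comm, ← Algebra.commutes (α j l), ← mul_assoc, ← map_mul,
    mul_comm (α j l), Algebra.smul_def]

theorem matrixPos_compress {p q : ℕ} (α : Matrix (Fin p) (Fin q) ℂ)
    {X : Matrix (Fin p) (Fin p) A} (hX : X ∈ matrixPos A p) : compress α X ∈ matrixPos A q := by
  obtain ⟨B, rfl⟩ := hX
  have := matrixPos_conj (B * α.map (algebraMap ℂ A))
  rwa [Matrix.conjTranspose_mul, Matrix.mul_assoc, ← Matrix.mul_assoc Bᴴ,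
    ← Matrix.mul_assoc, ← compress_eq_mul] at this

theorem matrixPos_order_unit {p : ℕ} (X : Matrix (Fin p) (Fin p) A) (hX : Xᴴ = X) :
    ∃ r : ℝ, 0 < r ∧ (r : ℂ) • diagUnit p (1 : A) + X ∈ matrixPos A p := by
  let _ : PartialOrder A := CStarAlgebra.spectralOrder A
  have _ : StarOrderedRing A := CStarAlgebra.spectralOrderedRing A
  have hsa : IsSelfAdjoint (CStarMatrix.ofMatrix X) := hX
  obtain ⟨r, hr, h⟩ := exists_pos_shift_nonneg hsa
  exact ⟨r, hr, (mem_matrixPos_iff_nonneg _).2 h⟩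

theorem matrixPos_archimedean {p : ℕ} (X : Matrix (Fin p) (Fin p) A)
    (h : ∀ ε : ℝ, 0 < ε → (ε : ℂ) • diagUnit p (1 : A) + X ∈ matrixPos A p) :
    X ∈ matrixPos A p := by
  let _ : PartialOrder A := CStarAlgebra.spectralOrder A
  have _ : StarOrderedRing A := CStarAlgebra.spectralOrderedRing A
  refine (mem_matrixPos_iff_nonneg _).2 ?_
  have hlim : Filter.Tendsto
      (fun ε : ℝ => ε • (1 : CStarMatrix (Fin p) (Fin p) A) + CStarMatrix.ofMatrix X)
      (nhdsWithin 0 (Set.Ioi 0)) (nhds (CStarMatrix.ofMatrix X)) := by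
    have hc : Continuous
        (fun ε : ℝ => ε • (1 : CStarMatrix (Fin p) (Fin p) A) + CStarMatrix.ofMatrix X) := by
      fun_prop
    have := (hc.tendsto 0).mono_left (nhdsWithin_le_nhds (s := Set.Ioi 0))
    simpa using this
  refine CStarAlgebra.isClosed_nonneg.mem_of_tendsto hlim ?_
  filter_upwards [self_mem_nhdsWithin] with ε hε
  have := (mem_matrixPos_iff_nonneg _).1 (h ε hε)
  change 0 ≤ (ε : ℂ) • (1 : CStarMatrix (Fin p) (Fin p) A) + CStarMatrix.ofMatrix X at this
  rwa [Complex.coe_smul] at this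

end MatrixPosFacts

namespace OperatorSubsystem

variable {A : Type*} [CStarAlgebra A]

instance : CoeSort (OperatorSubsystem A) (Type _) := ⟨fun S => S.toSubmodule⟩

variable (S : OperatorSubsystem A)

instance : Star S := ⟨fun x => ⟨star (x : A), S.star_mem' x.2⟩⟩

@[simp] theorem coe_star (x : S) : ((star x : S) : A) = star (x : A) := rfl

instance : StarAddMonoid S where
  star_involutive x := Subtype.ext (star_star (x : A))
  star_add x y := Subtype.ext (star_add (x : A) y)

instance : StarModule ℂ S where
  star_smul c x := Subtype.ext (star_smul c (x : A))

/-- The entrywise inclusion `M_p(S) ⊆ M_p(A)`. -/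
def incl {p : ℕ} (X : Matrix (Fin p) (Fin p) S) : Matrix (Fin p) (Fin p) A :=
  X.map fun x => (x : A)

theorem incl_injective {p : ℕ} : Function.Injective (incl S (p := p)) := fun X Y h => by
  ext i j
  exact congrFun (congrFun h i) j

theorem incl_compress {p q : ℕ} (α : Matrix (Fin p) (Fin q) ℂ) (X : Matrix (Fin p) (Fin p) S) :
    incl S (compress α X) = compress α (incl S X) := by
  ext k l
  simp [incl, compress]

theorem incl_unit {p : ℕ} (r : ℝ) (X : Matrix (Fin p) (Fin p) S) :
    incl S ((r : ℂ) • diagUnit p (⟨1, S.one_mem'⟩ : S) + X) =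
      (r : ℂ) • diagUnit p (1 : A) + incl S X := by
  ext i j
  by_cases h : i = j
  · subst h
    simp [incl, diagUnit]
  · simp [incl, diagUnit, h]

/-- The operator system structure inherited from the ambient C⋆-algebra:
`M_p(S)_+ = M_p(S) ∩ M_p(A)_+`, with order unit `1`. -/
instance instOperatorSystem : OperatorSystem S where
  pos p := {X | incl S X ∈ matrixPos A p}
  selfAdjoint_of_pos {p X} hX := incl_injective S (matrixPos_selfAdjoint (X := incl S X) hX)
  zero_pos p := matrixPos_zero p
  add_pos hX hY := matrixPos_add hX hY
  proper {p X} hX hY := incl_injective S (matrixPos_proper (X := incl S X) hX hY)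
  compress_pos {p q} α {X} hX := by
    change incl S (compress α X) ∈ matrixPos A q
    rw [incl_compress]
    exact matrixPos_compress α hX
  unit := ⟨1, S.one_mem'⟩
  star_unit := Subtype.ext (star_one A)
  order_unit {p} X hX := by
    obtain ⟨r, hr, h⟩ := matrixPos_order_unit (incl S X) (congrArg (incl S) hX)
    exact ⟨r, hr, by
      change incl S _ ∈ matrixPos A p
      rw [incl_unit]
      exact h⟩
  archimedean {p} X h := matrixPos_archimedean (incl S X) fun ε hε => by
    rw [← incl_unit]
    exact h ε hε

end OperatorSubsystem

/-! ### Duals of operator systems -/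

/-- The dual `S^d` of an operator system: the space of all linear functionals on `S`. (On a
finite-dimensional operator system every linear functional is bounded.) -/
def OpDual (S : Type*) [AddCommGroup S] [Module ℂ S] : Type _ := S →ₗ[ℂ] ℂ

namespace OpDual

section Basic

variable {S : Type*} [AddCommGroup S] [Module ℂ S]

instance : AddCommGroup (OpDual S) := inferInstanceAs (AddCommGroup (S →ₗ[ℂ] ℂ))

instance : Module ℂ (OpDual S) := inferInstanceAs (Module ℂ (S →ₗ[ℂ] ℂ))

instance : FunLike (OpDual S) S ℂ := inferInstanceAs (FunLike (S →ₗ[ℂ] ℂ) S ℂ)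

instance : LinearMapClass (OpDual S) ℂ S ℂ := inferInstanceAs (LinearMapClass (S →ₗ[ℂ] ℂ) ℂ S ℂ)

@[simp] theorem zero_apply (s : S) : (0 : OpDual S) s = 0 := rfl

@[simp] theorem add_apply (f g : OpDual S) (s : S) : (f + g) s = f s + g s := rfl

@[simp] theorem neg_apply (f : OpDual S) (s : S) : (-f) s = -f s := rfl

@[simp] theorem smul_apply (c : ℂ) (f : OpDual S) (s : S) : (c • f) s = c * f s := rfl

@[ext] theorem ext {f g : OpDual S} (h : ∀ s, f s = g s) : f = g := DFunLike.ext f g h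

theorem sum_apply {ι : Type*} (t : Finset ι) (f : ι → OpDual S) (s : S) :
    (∑ i ∈ t, f i) s = ∑ i ∈ t, f i s := by
  classical
  induction t using Finset.induction_on with
  | empty => simp
  | insert a t ha ih => rw [Finset.sum_insert ha, Finset.sum_insert ha, add_apply, ih]

variable [StarAddMonoid S] [StarModule ℂ S]

/-- The involution `f*(s) = conj (f (s*))`. -/
instance : Star (OpDual S) :=
  ⟨fun f => ({ toFun := fun s => star (f (star s))
               map_add' := fun s t => by simp
               map_smul' := fun c s => by simp [mul_comm] } : S →ₗ[ℂ] ℂ)⟩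

@[simp] theorem star_apply (f : OpDual S) (s : S) : (star f) s = star (f (star s)) := rfl

instance : StarAddMonoid (OpDual S) where
  star_involutive f := by ext s; simp
  star_add f g := by ext s; simp

instance : StarModule ℂ (OpDual S) where
  star_smul c f := by ext s; simp

end Basic

/-- For `G = [g_ij] ∈ M_p(S^d)`, the amplification to `M_q(S)` of the associated map
`Ĝ : S → M_p`, `Ĝ(s) = [g_ij(s)]`: the matrix `X = [x_kl]` is sent to `[Ĝ(x_kl)] ∈ M_q(M_p)`,
written as a scalar matrix indexed by `Fin q × Fin p`. -/
def hat {S : Type*} [AddCommGroup S] [Module ℂ S] {p q : ℕ}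
    (G : Matrix (Fin p) (Fin p) (OpDual S)) (X : Matrix (Fin q) (Fin q) S) :
    Matrix (Fin q × Fin p) (Fin q × Fin p) ℂ :=
  fun a b => G a.2 b.2 (X a.1 b.1)

section Cones

variable {S : Type*} [AddCommGroup S] [Module ℂ S] [StarAddMonoid S] [StarModule ℂ S]
  [OperatorSystem S]

/-- `M_p(S^d)_+`: the matrices `G` for which `Ĝ : S → M_p` is completely positive. -/
def posCone (S : Type*) [AddCommGroup S] [Module ℂ S] [StarAddMonoid S] [StarModule ℂ S]
    [OperatorSystem S] (p : ℕ) : Set (Matrix (Fin p) (Fin p) (OpDual S)) :=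
  {G | ∀ (q : ℕ) (X : Matrix (Fin q) (Fin q) S),
    X ∈ MatrixOrderedSpace.pos q → (hat G X).PosSemidef}

/-- Functionals that agree on the positive elements are equal. -/
theorem eq_of_eq_on_pos {f g : OpDual S}
    (h : ∀ x : S, (Matrix.of fun _ _ => x : Matrix (Fin 1) (Fin 1) S) ∈
      MatrixOrderedSpace.pos 1 → f x = g x) : f = g := by
  have hsa : ∀ x : S, star x = x → f x = g x := by
    intro x hx
    obtain ⟨r, hr, h1⟩ := OperatorSystem.order_unit
      (Matrix.of fun _ _ => x : Matrix (Fin 1) (Fin 1) S) (by ext i j; simpa using hx)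
    obtain ⟨t, ht, h2⟩ := OperatorSystem.order_unit (0 : Matrix (Fin 1) (Fin 1) S) (by simp)
    have e1 : (r : ℂ) • diagUnit 1 (OperatorSystem.unit : S) + Matrix.of (fun _ _ => x) =
        Matrix.of fun _ _ => (r : ℂ) • (OperatorSystem.unit : S) + x := by
      ext i j
      simp [diagUnit, Subsingleton.elim i j]
    have e2 : (t : ℂ) • diagUnit 1 (OperatorSystem.unit : S) + 0 =
        Matrix.of fun _ _ => (t : ℂ) • (OperatorSystem.unit : S) := by
      ext i j
      simp [diagUnit, Subsingleton.elim i j]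
    rw [e1] at h1
    rw [e2] at h2
    have h1' := h _ h1
    have h2' := h _ h2
    simp only [map_add, map_smul, smul_eq_mul] at h1' h2'
    have ht' : (t : ℂ) ≠ 0 := by exact_mod_cast ht.ne'
    rw [mul_left_cancel₀ ht' h2'] at h1'
    exact add_left_cancel h1'
  ext s
  have hre : star (realPart s : S) = realPart s := (realPart s).2
  have him : star (imaginaryPart s : S) = imaginaryPart s := (imaginaryPart s).2
  rw [← realPart_add_I_smul_imaginaryPart s]
  simp [hsa _ hre, hsa _ him]

/-- The dual of an operator system as a matricially ordered space. -/
instance instMatrixOrderedSpace : MatrixOrderedSpace (OpDual S) where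
  pos p := posCone S p
  selfAdjoint_of_pos {p G} hG := by
    ext i j : 1
    refine eq_of_eq_on_pos fun x hx => ?_
    have h := (hG 1 _ hx).isHermitian
    have h' := congrFun (congrFun h (0, i)) (0, j)
    have hs : star x = x := by
      simpa using congrFun (congrFun (MatrixOrderedSpace.selfAdjoint_of_pos hx) 0) 0
    simpa [hat, hs] using h'
  zero_pos p q X _ := by
    have : hat (0 : Matrix (Fin p) (Fin p) (OpDual S)) X = 0 := by ext; simp [hat]
    rw [this]
    exact Matrix.PosSemidef.zero
  add_pos {p G H} hG hH q X hX := by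
    have : hat (G + H) X = hat G X + hat H X := by ext; simp [hat]
    rw [this]
    exact (hG q X hX).add (hH q X hX)
  proper {p G} hG hH := by
    ext i j : 1
    refine eq_of_eq_on_pos fun x hx => ?_
    have h1 := (hG 1 _ hx)
    have h2 := (hH 1 _ hx)
    have e : hat (-G) (Matrix.of fun _ _ => x : Matrix (Fin 1) (Fin 1) S) =
        -hat G (Matrix.of fun _ _ => x) := by ext; simp [hat]
    rw [e] at h2
    have h3 : hat G (Matrix.of fun _ _ => x : Matrix (Fin 1) (Fin 1) S) = 0 := by
      open scoped MatrixOrder in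
      exact le_antisymm (neg_nonneg.1 (Matrix.nonneg_iff_posSemidef.2 h2))
        (Matrix.nonneg_iff_posSemidef.2 h1)
    simpa [hat] using congrFun (congrFun h3 (0, i)) (0, j)
  compress_pos {p r} α {G} hG q X hX := by
    have key : hat (compress α G) X =
        (Matrix.of fun (a : Fin q × Fin p) (b : Fin q × Fin r) =>
          if a.1 = b.1 then α a.2 b.2 else 0)ᴴ * hat G X *
        (Matrix.of fun (a : Fin q × Fin p) (b : Fin q × Fin r) =>
          if a.1 = b.1 then α a.2 b.2 else 0) := by
      ext ⟨k, i⟩ ⟨l, j⟩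
      simp only [hat, compress, Matrix.mul_apply, Matrix.conjTranspose_apply, Matrix.of_apply,
        Fintype.sum_prod_type, Finset.sum_mul, sum_apply, smul_apply]
      rw [Finset.sum_comm]
      rw [Finset.sum_eq_single l]
      · refine Finset.sum_congr rfl fun b _ => ?_
        rw [Finset.sum_eq_single k]
        · refine Finset.sum_congr rfl fun a _ => ?_
          simp
          ring
        · intro k' _ hk
          simp [hk]
        · simp
      · intro l' _ hl
        simp [hl]
      · simp
    rw [key]
    exact (hG q X hX).conjTranspose_mul_mul_same _

end Cones

end OpDual

/-! ### The full group C⋆-algebra and the universal unitaries -/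

/-- A unitary representation of a group on a nonzero complex Hilbert space. -/
structure UnitaryRep (G : Type*) [Group G] where
  /-- the Hilbert space -/
  space : Type
  [normedAddCommGroup : NormedAddCommGroup space]
  [innerProductSpace : InnerProductSpace ℂ space]
  [completeSpace : CompleteSpace space]
  [nontrivial : Nontrivial space]
  /-- the representation -/
  rep : G →* unitary (space →L[ℂ] space)

attribute [instance] UnitaryRep.normedAddCommGroup UnitaryRep.innerProductSpace
  UnitaryRep.completeSpace UnitaryRep.nontrivial

variable {G : Type} [Group G]

/-- The bounded operators on the space of a representation. -/
abbrev UnitaryRep.Op (π : UnitaryRep G) : Type := π.space →L[ℂ] π.space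

/-- The C⋆-algebra of all bounded families of operators `(T_π)_π`, `T_π ∈ B(H_π)`, where `π` runs
over all unitary representations of `G`, with the supremum norm. -/
abbrev UnivProd (G : Type) [Group G] : Type 1 := lp (fun π : UnitaryRep G => π.Op) ∞

instance : CStarAlgebra (UnivProd G) where

/-- The image of a group element in the universal representation `g ↦ (π(g))_π`. -/
def univElem (g : G) : UnivProd G :=
  ⟨fun π => (π.rep g : π.Op), memℓp_infty ⟨1, by
    rintro _ ⟨π, rfl⟩
    exact (CStarRing.norm_coe_unitary (π.rep g)).le⟩⟩

/-- The full group C⋆-algebra `C*(G)` of a discrete group: the closed unital `*`-subalgebra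
generated by the image of `G` under the universal representation. Equivalently, the completion
of `ℂ[G]` in the norm `‖a‖ = sup_π ‖π(a)‖`. -/
def fullGroupSubalgebra (G : Type) [Group G] : StarSubalgebra ℂ (UnivProd G) :=
  (StarAlgebra.adjoin ℂ (Set.range (univElem (G := G)))).topologicalClosure

/-- `C*(G)` as a type. -/
def FullGroupCStar (G : Type) [Group G] : Type 1 := fullGroupSubalgebra G

instance : CStarAlgebra (FullGroupCStar G) :=
  haveI : IsClosed (fullGroupSubalgebra G : Set (UnivProd G)) :=
    StarSubalgebra.isClosed_topologicalClosure _
  inferInstanceAs (CStarAlgebra (fullGroupSubalgebra G))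

/-- The canonical image of a group element in `C*(G)`. -/
def groupElem (g : G) : FullGroupCStar G :=
  ⟨univElem g, StarSubalgebra.le_topologicalClosure _
    (StarAlgebra.subset_adjoin ℂ _ (Set.mem_range_self g))⟩

/-- The universal unitaries `u_1, …, u_m` generating `C*(F_m)`: the images of the free
generators. -/
def universalUnitary (m : ℕ) (j : Fin m) : FullGroupCStar (FreeGroup (Fin m)) :=
  groupElem (FreeGroup.of j)

/-! ### The operator systems -/

/-- `Span {1, u_j, u_j^* : 1 ≤ j ≤ m}` inside `C*(F_m)`. -/
def freeSystem (m : ℕ) : OperatorSubsystem (FullGroupCStar (FreeGroup (Fin m))) where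
  toSubmodule := Submodule.span ℂ
    ({1} ∪ Set.range (universalUnitary m) ∪ Set.range fun j => star (universalUnitary m j))
  one_mem' := Submodule.subset_span (by simp)
  star_mem' {a} ha := by
    change a ∈ Submodule.span ℂ _ at ha
    change star a ∈ Submodule.span ℂ _
    induction ha using Submodule.span_induction with
    | mem x hx =>
      refine Submodule.subset_span ?_
      rcases hx with (hx | ⟨j, rfl⟩) | ⟨j, rfl⟩
      · left; left
        rw [Set.mem_singleton_iff] at hx ⊢
        rw [hx, star_one]
      · right
        exact ⟨j, rfl⟩
      · left; right
        exact ⟨j, (star_star _).symm⟩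
    | zero => rw [star_zero]; exact Submodule.zero_mem _
    | add x y _ _ hx hy => rw [star_add]; exact Submodule.add_mem _ hx hy
    | smul c x _ hx => rw [star_smul]; exact Submodule.smul_mem _ _ hx

/-- The tridiagonal matrices in `M_n(ℂ)`. -/
def tridiagonalSystem (n : ℕ) : OperatorSubsystem (CStarMatrix (Fin n) (Fin n) ℂ) where
  carrier := {M | ∀ i j : Fin n, 2 ≤ |((i : ℕ) : ℤ) - ((j : ℕ) : ℤ)| → M i j = 0}
  zero_mem' _ _ _ := rfl
  add_mem' {M N} hM hN i j h := by rw [CStarMatrix.add_apply, hM i j h, hN i j h, add_zero]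
  smul_mem' c M hM i j h := by rw [CStarMatrix.smul_apply, hM i j h, smul_zero]
  one_mem' i j h := by
    rw [CStarMatrix.one_apply, if_neg]
    rintro rfl
    simp at h
  star_mem' {M} hM i j h := by
    rw [CStarMatrix.star_apply, hM j i (by rwa [abs_sub_comm]), star_zero]

/-- The C⋆-algebra `⊕_{k=1}^m M_2(ℂ)`. -/
abbrev SumM2 (m : ℕ) : Type := Fin m → CStarMatrix (Fin 2) (Fin 2) ℂ

/-- `V_n ⊆ ⊕_{k=1}^{n-1} M_2`: the lower right entry of each block is the upper left entry of the
next block. -/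
def systemV (n : ℕ) : OperatorSubsystem (SumM2 (n - 1)) where
  carrier := {a | ∀ k l : Fin (n - 1), (l : ℕ) = (k : ℕ) + 1 → a k 1 1 = a l 0 0}
  zero_mem' _ _ _ := rfl
  add_mem' {a b} ha hb k l h := by
    simp only [Pi.add_apply, CStarMatrix.add_apply, ha k l h, hb k l h]
  smul_mem' c a ha k l h := by
    simp only [Pi.smul_apply, CStarMatrix.smul_apply, ha k l h]
  one_mem' k l h := by simp
  star_mem' {a} ha k l h := by
    simp only [Pi.star_apply, CStarMatrix.star_apply, ha k l h]

/-- `U_n ⊆ ⊕_{k=1}^{n-1} M_2`: all diagonal entries of all blocks are equal. -/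
def systemU (n : ℕ) : OperatorSubsystem (SumM2 (n - 1)) where
  carrier := {a | ∀ (k l : Fin (n - 1)) (i j : Fin 2), a k i i = a l j j}
  zero_mem' _ _ _ _ := rfl
  add_mem' {a b} ha hb k l i j := by
    simp only [Pi.add_apply, CStarMatrix.add_apply, ha k l i j, hb k l i j]
  smul_mem' c a ha k l i j := by
    simp only [Pi.smul_apply, CStarMatrix.smul_apply, ha k l i j]
  one_mem' k l i j := by simp
  star_mem' {a} ha k l i j := by
    simp only [Pi.star_apply, CStarMatrix.star_apply, ha k l i j]

end OpSys

end

/-!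
By Gram factorization, a positive matrix over `⊕ M_r` is the same as families of vectors `c k i a`
such that its entries are the inner products `⟪c k i a, c k j b⟫`. A functional on `𝒯_n` or
`𝒮_{n-1}` is sent to its values at the entries of suitable positive `2 × 2` matrices `E_k` over the
system: the `k`-th diagonal block of matrix units, respectively `[1, u_k; u_k^*, 1]`. Such a map is
completely positive because the `E_k` are positive, and injective because their entries span.

The point is to lift a positive matrix over `𝒱_n` or `𝒰_n`, given by vectors `c k i a`, to a
positive matrix of functionals; surjectivity then comes for free, as positive elements span an
operator system. The defining relations of `𝒱_n` and `𝒰_n` say that certain families of vectors have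
the same Gram matrix, so that a unitary carries one to the other. For `𝒱_n`, composing these
unitaries moves all blocks into a single sequence `v i a` with `v (k + 1)` shared by the blocks `k`
and `k + 1`, and the functionals `E_ij ↦ ⟪v i a, v j b⟫` form the lift. For `𝒰_n`, all families
`c k i` are unitary images `W k i` of one family `v`, and the lift consists of the coefficient
functionals `⟪v a, π(·) (v b)⟫` of the representation `π` of `C*(𝔽_{n-1})` that sends `u_k` to
`(W k 0)⁻¹ (W k 1)`.
-/

noncomputable section

namespace OpSys

section Gram

variable {𝕜 H : Type*} [RCLike 𝕜] [NormedAddCommGroup H] [InnerProductSpace 𝕜 H]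

theorem norm_linearCombination_eq_of_gram_eq {ι : Type*} {r s : ι → H}
    (h : Matrix.gram 𝕜 r = Matrix.gram 𝕜 s) (x : ι →₀ 𝕜) :
    ‖Finsupp.linearCombination 𝕜 r x‖ = ‖Finsupp.linearCombination 𝕜 s x‖ := by
  have hinner : ∀ a b, inner 𝕜 (r a) (r b) = inner 𝕜 (s a) (s b) := fun a b =>
    congrFun (congrFun h a) b
  simp only [norm_eq_sqrt_re_inner (𝕜 := 𝕜), Finsupp.linearCombination_apply, Finsupp.sum_inner,
    Finsupp.inner_sum, inner_smul_left, inner_smul_right, hinner]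

theorem exists_linearIsometryEquiv_of_gram_eq [FiniteDimensional 𝕜 H] {ι : Type*} {r s : ι → H}
    (h : Matrix.gram 𝕜 r = Matrix.gram 𝕜 s) : ∃ W : H ≃ₗᵢ[𝕜] H, ∀ a, W (r a) = s a := by
  have : CompleteSpace H := FiniteDimensional.complete 𝕜 H
  let R := (Finsupp.linearCombination 𝕜 r).rangeRestrict
  let S := Finsupp.linearCombination 𝕜 s
  have hnorm (x) : ‖S x‖ = ‖R x‖ := (norm_linearCombination_eq_of_gram_eq h x).symm
  have hdense : DenseRange R := (Finsupp.linearCombination 𝕜 r).surjective_rangeRestrict.denseRange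
  let L := S.extendOfNorm R
  have hL (x) : L (R x) = S x :=
    LinearMap.extendOfNorm_eq hdense ⟨1, fun x => by rw [one_mul, hnorm]⟩ x
  let V : LinearMap.range (Finsupp.linearCombination 𝕜 r) →ₗᵢ[𝕜] H :=
    { (L : _ →ₗ[𝕜] H) with
      norm_map' := by
        rintro ⟨_, x, rfl⟩
        exact (congrArg norm (hL x)).trans (hnorm x) }
  refine ⟨V.extend.toLinearIsometryEquiv rfl, fun a => ?_⟩
  calc V.extend (r a)
    _ = V.extend (R (Finsupp.single a 1)) := by simp [R]
    _ = L (R (Finsupp.single a 1)) := V.extend_apply _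
    _ = s a := by simp [hL, S]

theorem exists_gram_eq_of_posSemidef {κ : Type*} [Fintype κ] {M : Matrix κ κ 𝕜}
    (hM : M.PosSemidef) : ∃ c : κ → EuclideanSpace 𝕜 κ, Matrix.gram 𝕜 c = M := by
  classical
  open scoped MatrixOrder in
  obtain ⟨C, rfl⟩ := CStarAlgebra.nonneg_iff_eq_star_mul_self.1 (Matrix.nonneg_iff_posSemidef.2 hM)
  refine ⟨fun x => WithLp.toLp 2 fun z => C z x, ?_⟩
  ext x y
  simp [Matrix.mul_apply, PiLp.inner_apply, Matrix.star_eq_conjTranspose, mul_comm]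

end Gram

theorem submodule_eq_top_of_forall_pos_mem {V : Type*} [AddCommGroup V] [Module ℂ V]
    [StarAddMonoid V] [StarModule ℂ V] [OperatorSystem V] {p : Submodule ℂ V}
    (h : ∀ v : V, Matrix.of (fun _ _ => v) ∈ MatrixOrderedSpace.pos 1 → v ∈ p) : p = ⊤ := by
  by_contra hne
  obtain ⟨f, hf, hker⟩ := Submodule.exists_le_ker_of_lt_top _ (lt_top_iff_ne_top.2 hne)
  exact hf (OpDual.eq_of_eq_on_pos (f := f) (g := 0) fun v hv => hker (h v hv))

theorem completelyOrderIsomorphic_of_pos_lift {V W : Type*} [AddCommGroup V] [Module ℂ V]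
    [StarAddMonoid V] [StarModule ℂ V] [MatrixOrderedSpace V] [AddCommGroup W] [Module ℂ W]
    [StarAddMonoid W] [StarModule ℂ W] [OperatorSystem W] (φ : V →ₗ[ℂ] W)
    (hinj : Function.Injective φ) (hpos : IsCompletelyPositive φ)
    (hlift : ∀ (p : ℕ) (Y : Matrix (Fin p) (Fin p) W), Y ∈ MatrixOrderedSpace.pos p →
      ∃ X ∈ MatrixOrderedSpace.pos p, X.map φ = Y) :
    CompletelyOrderIsomorphic V W := by
  have hrange : LinearMap.range φ = ⊤ := submodule_eq_top_of_forall_pos_mem fun w hw => by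
    obtain ⟨X, -, hX⟩ := hlift 1 _ hw
    exact ⟨X 0 0, congrFun (congrFun hX 0) 0⟩
  let e := LinearEquiv.ofBijective φ ⟨hinj, LinearMap.range_eq_top.1 hrange⟩
  refine ⟨e, hpos, fun p Y hY => ?_⟩
  obtain ⟨X, hX, rfl⟩ := hlift p Y hY
  have hsymm : (X.map φ).map e.symm = X := Matrix.ext fun i j => e.symm_apply_apply (X i j)
  exact hsymm.symm ▸ hX

section DualPositivity

variable {A K : Type*} [CStarAlgebra A] [NormedAddCommGroup K] [InnerProductSpace ℂ K]

/-- The restriction of a linear functional on a C⋆-algebra to an operator subsystem. -/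
def restrictDual (S : OperatorSubsystem A) (f : A →ₗ[ℂ] ℂ) : OpDual S :=
  f.domRestrict S.toSubmodule

@[simp] theorem restrictDual_apply (S : OperatorSubsystem A) (f : A →ₗ[ℂ] ℂ) (s : S) :
    restrictDual S f s = f s := rfl

theorem map_restrictDual_mem_pos_of_inner (S : OperatorSubsystem A) {p : ℕ}
    {F : Matrix (Fin p) (Fin p) (A →ₗ[ℂ] ℂ)} (Λ : Fin p → A → K)
    (hF : ∀ a b x y, F a b (star x * y) = inner ℂ (Λ a x) (Λ b y)) :
    F.map (restrictDual S) ∈ MatrixOrderedSpace.pos p := by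
  rintro q X ⟨B, hB⟩
  have hX (k l) : (X k l : A) = ∑ x, star (B x k) * B x l := congrFun (congrFun hB k) l
  have hgram : OpDual.hat (F.map (restrictDual S)) X =
      ∑ x, Matrix.gram ℂ fun ka : Fin q × Fin p => Λ ka.2 (B x ka.1) := by
    ext ka lb
    simp only [OpDual.hat, Matrix.map_apply, restrictDual_apply, hX, map_sum, hF,
      Matrix.sum_apply, Matrix.gram_apply]
  rw [hgram]
  exact Matrix.posSemidef_sum _ fun x _ => Matrix.posSemidef_gram ℂ _

variable {H : Type*} [NormedAddCommGroup H] [InnerProductSpace ℂ H] [CompleteSpace H]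

/-- The coefficient functional `s ↦ ⟪v, π(s) w⟫` of a representation `π`. -/
def vectorFunctional (π : A →⋆ₐ[ℂ] (H →L[ℂ] H)) (v w : H) : A →ₗ[ℂ] ℂ where
  toFun s := inner ℂ v (π s w)
  map_add' s t := by simp
  map_smul' c s := by simp

theorem vectorFunctional_star_mul (π : A →⋆ₐ[ℂ] (H →L[ℂ] H)) (v w : H) (s t : A) :
    vectorFunctional π v w (star s * t) = inner ℂ (π s v) (π t w) := by
  change inner ℂ v (π (star s * t) w) = _
  rw [map_mul, map_star, ContinuousLinearMap.star_eq_adjoint, mul_apply_eq_comp,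
    ContinuousLinearMap.adjoint_inner_right]

theorem vectorFunctional_mem_pos (S : OperatorSubsystem A) (π : A →⋆ₐ[ℂ] (H →L[ℂ] H)) {p : ℕ}
    (v : Fin p → H) :
    (Matrix.of fun a b => restrictDual S (vectorFunctional π (v a) (v b))) ∈
      MatrixOrderedSpace.pos p :=
  map_restrictDual_mem_pos_of_inner S (F := Matrix.of fun a b => vectorFunctional π (v a) (v b))
    (fun a x => π x (v a)) fun a b => vectorFunctional_star_mul π (v a) (v b)

variable {κ : Type*} [Fintype κ]

/-- The functional on matrices that takes the value `⟪v i, w j⟫` at the matrix unit `E_ij`. -/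
def gramFunctional (v w : κ → K) : CStarMatrix κ κ ℂ →ₗ[ℂ] ℂ where
  toFun M := ∑ i, ∑ j, M i j * inner ℂ (v i) (w j)
  map_add' M N := by
    simp only [CStarMatrix.add_apply, add_mul, Finset.sum_add_distrib]
  map_smul' c M := by
    simp only [CStarMatrix.smul_apply, smul_eq_mul, mul_assoc, Finset.mul_sum, RingHom.id_apply]

theorem gramFunctional_single [DecidableEq κ] (v w : κ → K) (i j : κ) :
    gramFunctional v w (CStarMatrix.ofMatrix (Matrix.single i j 1)) = inner ℂ (v i) (w j) := by
  change ∑ a, ∑ b, Matrix.single i j (1 : ℂ) a b * inner ℂ (v a) (w b) = _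
  simp [Matrix.single_apply, ite_and]

theorem gramFunctional_star_mul (v w : κ → K) (M N : CStarMatrix κ κ ℂ) :
    gramFunctional v w (star M * N) =
      inner ℂ (WithLp.toLp 2 fun l => ∑ i, M l i • v i : PiLp 2 fun _ : κ => K)
        (WithLp.toLp 2 fun l => ∑ j, N l j • w j) := by
  change ∑ i, ∑ j, (star M * N) i j * inner ℂ (v i) (w j) = _
  simp only [CStarMatrix.mul_apply, CStarMatrix.star_apply, PiLp.inner_apply, sum_inner, inner_sum,
    inner_smul_left, inner_smul_right, Finset.sum_mul, Finset.mul_sum]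
  rw [Finset.sum_comm_cycle]
  refine Finset.sum_congr rfl fun l _ => ?_
  rw [Finset.sum_comm]
  refine Finset.sum_congr rfl fun j _ => Finset.sum_congr rfl fun i _ => ?_
  rw [Complex.star_def]
  ring

theorem gramFunctional_mem_pos [DecidableEq κ] (S : OperatorSubsystem (CStarMatrix κ κ ℂ)) {p : ℕ}
    (v : Fin p → κ → K) :
    (Matrix.of fun a b => restrictDual S (gramFunctional (v a) (v b))) ∈
      MatrixOrderedSpace.pos p :=
  map_restrictDual_mem_pos_of_inner S (F := Matrix.of fun a b => gramFunctional (v a) (v b))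
    (fun a M => WithLp.toLp 2 fun l => ∑ i, M l i • v a i)
    fun a b => gramFunctional_star_mul (v a) (v b)

end DualPositivity

section Blocks

variable {κ H : Type*} [NormedAddCommGroup H] [InnerProductSpace ℂ H] {p r : ℕ}

theorem star_mul_mem_matrixPos {A : Type*} [CStarAlgebra A] (x : Fin p → A) :
    Matrix.of (fun i j => star (x i) * x j) ∈ matrixPos A p := by
  have hrow : Matrix.of (fun i j => star (x i) * x j) =
      (Matrix.replicateRow (Fin 1) x)ᴴ * Matrix.replicateRow (Fin 1) x := by
    ext i j
    simp [Matrix.mul_apply]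
  exact hrow ▸ matrixPos_conj _

/-- The matrix over `⊕_κ M_r` whose blocks have the entries `⟪c k i a, c k j b⟫`, where `i, j` run
over the rows and columns of `M_r`, and `a, b` over those of the outer matrix. -/
def gramBlocks (c : κ → Fin r → Fin p → H) :
    Matrix (Fin p) (Fin p) (κ → CStarMatrix (Fin r) (Fin r) ℂ) :=
  Matrix.of fun a b k => CStarMatrix.ofMatrix (Matrix.of fun i j => inner ℂ (c k i a) (c k j b))

@[simp] theorem gramBlocks_apply (c : κ → Fin r → Fin p → H) (a b : Fin p) (k : κ)
    (i j : Fin r) :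
    gramBlocks c a b k i j = inner ℂ (c k i a) (c k j b) := rfl

theorem conjTranspose_mul_eq_gramBlocks
    (B : Matrix (Fin p) (Fin p) (κ → CStarMatrix (Fin r) (Fin r) ℂ)) :
    Bᴴ * B = gramBlocks fun k i a =>
      WithLp.toLp 2 fun d : Fin r × Fin p => B d.2 a k d.1 i := by
  have hsum (f : Fin p → CStarMatrix (Fin r) (Fin r) ℂ) (i j : Fin r) :
      (∑ d, f d) i j = ∑ d, f d i j := Matrix.sum_apply i j Finset.univ f
  ext a b : 1
  funext k
  ext i j
  simp only [Matrix.mul_apply, Matrix.conjTranspose_apply, Finset.sum_apply, Pi.mul_apply,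
    Pi.star_apply, hsum, CStarMatrix.mul_apply, CStarMatrix.star_apply, gramBlocks_apply,
    PiLp.inner_apply, Fintype.sum_prod_type, RCLike.inner_apply']
  exact Finset.sum_comm

theorem mem_matrixPos_iff_exists_gramBlocks [Fintype κ]
    {Y : Matrix (Fin p) (Fin p) (κ → CStarMatrix (Fin r) (Fin r) ℂ)} :
    Y ∈ matrixPos (κ → CStarMatrix (Fin r) (Fin r) ℂ) p ↔
      ∃ c : κ → Fin r → Fin p → EuclideanSpace ℂ (Fin r × Fin p), gramBlocks c = Y := by
  constructor
  · rintro ⟨B, rfl⟩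
    exact ⟨_, (conjTranspose_mul_eq_gramBlocks B).symm⟩
  · rintro ⟨c, rfl⟩
    let B : Matrix (Fin p) (Fin p) (κ → CStarMatrix (Fin r) (Fin r) ℂ) :=
      Matrix.of fun d a k => CStarMatrix.ofMatrix (Matrix.of fun e i => c k i a (e, d))
    exact ⟨B, (conjTranspose_mul_eq_gramBlocks B).symm⟩

variable {S : Type*} [AddCommGroup S] [Module ℂ S]

/-- The evaluation `f ↦ ⊕_k [f(E_k i j)]` of functionals at the entries of a family of matrices. -/
def blockEval (E : κ → Matrix (Fin r) (Fin r) S) :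
    OpDual S →ₗ[ℂ] (κ → CStarMatrix (Fin r) (Fin r) ℂ) where
  toFun f k := CStarMatrix.ofMatrix ((E k).map f)
  map_add' _ _ := rfl
  map_smul' _ _ := rfl

theorem blockEval_injective {E : κ → Matrix (Fin r) (Fin r) S}
    (hspan : Submodule.span ℂ (Set.range fun x : κ × Fin r × Fin r => E x.1 x.2.1 x.2.2) = ⊤) :
    Function.Injective (blockEval E) := fun _ _ hfg =>
  LinearMap.ext_on_range hspan fun x =>
    congrFun (congrFun (congrFun hfg x.1) x.2.1) x.2.2

variable [Fintype κ] [StarAddMonoid S] [StarModule ℂ S] [OperatorSystem S]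

theorem map_blockEval_mem_matrixPos {E : κ → Matrix (Fin r) (Fin r) S}
    (hE : ∀ k, E k ∈ MatrixOrderedSpace.pos r) {G : Matrix (Fin p) (Fin p) (OpDual S)}
    (hG : G ∈ MatrixOrderedSpace.pos p) :
    G.map (blockEval E) ∈ matrixPos (κ → CStarMatrix (Fin r) (Fin r) ℂ) p := by
  choose c hc using fun k => exists_gram_eq_of_posSemidef (hG r (E k) (hE k))
  refine mem_matrixPos_iff_exists_gramBlocks.2 ⟨fun k i a => c k (i, a), ?_⟩
  ext a b : 1
  funext k
  ext i j
  exact congrFun (congrFun (hc k) (i, a)) (j, b)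

theorem completelyOrderIsomorphic_of_blockEval
    {W : OperatorSubsystem (κ → CStarMatrix (Fin r) (Fin r) ℂ)} {E : κ → Matrix (Fin r) (Fin r) S}
    (hE : ∀ k, E k ∈ MatrixOrderedSpace.pos r)
    (hspan : Submodule.span ℂ (Set.range fun x : κ × Fin r × Fin r => E x.1 x.2.1 x.2.2) = ⊤)
    (hW : ∀ f, blockEval E f ∈ W.toSubmodule)
    (hlift : ∀ (p : ℕ) (c : κ → Fin r → Fin p → EuclideanSpace ℂ (Fin r × Fin p)),
      (∀ a b, gramBlocks c a b ∈ W.toSubmodule) →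
        ∃ G ∈ MatrixOrderedSpace.pos p, G.map (blockEval E) = gramBlocks c) :
    CompletelyOrderIsomorphic (OpDual S) W := by
  refine completelyOrderIsomorphic_of_pos_lift ((blockEval E).codRestrict W.toSubmodule hW)
    (fun f g hfg => blockEval_injective hspan (congrArg Subtype.val hfg))
    (fun p G hG => map_blockEval_mem_matrixPos hE hG) fun p Y hY => ?_
  obtain ⟨c, hc⟩ := mem_matrixPos_iff_exists_gramBlocks.1 hY
  have hcY (a b) : gramBlocks c a b = Y a b := congrFun (congrFun hc a) b
  obtain ⟨G, hG, hGc⟩ := hlift p c fun a b => hcY a b ▸ (Y a b).2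
  exact ⟨G, hG, W.incl_injective (hGc.trans hc)⟩

end Blocks

section Tridiagonal

variable {m : ℕ}

/-- The two indices `k, k + 1` met by the `k`-th diagonal `2 × 2` block of a tridiagonal matrix. -/
def blockIndex (k : Fin m) : Fin 2 → Fin (m + 1) :=
  ![k.castSucc, k.succ]

theorem abs_blockIndex_sub_lt_two (k : Fin m) (i j : Fin 2) :
    |((blockIndex k i : ℕ) : ℤ) - ((blockIndex k j : ℕ) : ℤ)| < 2 := by
  fin_cases i <;> fin_cases j <;> simp [blockIndex]

theorem exists_blockIndex_of_abs_sub_lt_two {a b : Fin (m + 2)}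
    (h : |((a : ℕ) : ℤ) - ((b : ℕ) : ℤ)| < 2) :
    ∃ (k : Fin (m + 1)) (i j : Fin 2), blockIndex k i = a ∧ blockIndex k j = b := by
  rw [abs_lt] at h
  rcases lt_trichotomy a b with hab | rfl | hab
  · exact ⟨⟨a, by omega⟩, 0, 1, rfl, Fin.ext (show (a : ℕ) + 1 = b by omega)⟩
  · cases a using Fin.cases with
    | zero => exact ⟨0, 0, 0, rfl, rfl⟩
    | succ k => exact ⟨k, 1, 1, rfl, rfl⟩
  · exact ⟨⟨b, by omega⟩, 1, 0, Fin.ext (show (b : ℕ) + 1 = a by omega), rfl⟩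

theorem single_mem_tridiagonalSystem {n : ℕ} {a b : Fin n}
    (h : |((a : ℕ) : ℤ) - ((b : ℕ) : ℤ)| < 2) :
    CStarMatrix.ofMatrix (Matrix.single a b (1 : ℂ)) ∈ (tridiagonalSystem n).toSubmodule := by
  intro i j hij
  refine Matrix.single_apply_of_ne _ _ _ _ _ ?_
  rintro ⟨rfl, rfl⟩
  exact h.not_ge hij

/-- The matrix over the tridiagonal matrices whose entries are the matrix units of the `k`-th
diagonal `2 × 2` block. -/
def tridiagonalBlock (k : Fin m) : Matrix (Fin 2) (Fin 2) (tridiagonalSystem (m + 1)) :=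
  Matrix.of fun i j => ⟨CStarMatrix.ofMatrix (Matrix.single (blockIndex k i) (blockIndex k j) 1),
    single_mem_tridiagonalSystem (abs_blockIndex_sub_lt_two k i j)⟩

theorem tridiagonalBlock_mem_pos (k : Fin m) :
    tridiagonalBlock k ∈ MatrixOrderedSpace.pos 2 := by
  have hblock : OperatorSubsystem.incl _ (tridiagonalBlock k) =
      Matrix.of fun i j =>
        star (CStarMatrix.ofMatrix (Matrix.single (0 : Fin (m + 1)) (blockIndex k i) (1 : ℂ))) *
          CStarMatrix.ofMatrix (Matrix.single 0 (blockIndex k j) 1) := by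
    ext i j : 1
    change Matrix.single (blockIndex k i) (blockIndex k j) (1 : ℂ) =
      (Matrix.single (0 : Fin (m + 1)) (blockIndex k i) 1)ᴴ * Matrix.single 0 (blockIndex k j) 1
    simp
  change OperatorSubsystem.incl _ _ ∈ matrixPos _ _
  exact hblock ▸ star_mul_mem_matrixPos _

theorem span_range_single_blockIndex :
    Submodule.span ℂ (Set.range fun x : Fin (m + 1) × Fin 2 × Fin 2 =>
      CStarMatrix.ofMatrix (Matrix.single (blockIndex x.1 x.2.1) (blockIndex x.1 x.2.2) (1 : ℂ))) =
      (tridiagonalSystem (m + 2)).toSubmodule := by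
  refine le_antisymm (Submodule.span_le.2 ?_) fun M hM => ?_
  · rintro _ ⟨x, rfl⟩
    exact single_mem_tridiagonalSystem (abs_blockIndex_sub_lt_two _ _ _)
  · have hsum : M = ∑ a, ∑ b, M a b • CStarMatrix.ofMatrix (Matrix.single a b (1 : ℂ)) := by
      refine (Matrix.matrix_eq_sum_single M).trans ?_
      refine Finset.sum_congr rfl fun a _ => Finset.sum_congr rfl fun b _ => ?_
      change _ = M a b • Matrix.single a b (1 : ℂ)
      rw [Matrix.smul_single, smul_eq_mul, mul_one]
    rw [hsum]
    refine Submodule.sum_mem _ fun a _ => Submodule.sum_mem _ fun b _ => ?_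
    rcases lt_or_ge |((a : ℕ) : ℤ) - ((b : ℕ) : ℤ)| 2 with hab | hab
    · obtain ⟨k, i, j, rfl, rfl⟩ := exists_blockIndex_of_abs_sub_lt_two hab
      exact Submodule.smul_mem _ _ (Submodule.subset_span ⟨(k, i, j), rfl⟩)
    · rw [hM a b hab, zero_smul]
      exact Submodule.zero_mem _

theorem span_range_tridiagonalBlock :
    Submodule.span ℂ (Set.range fun x : Fin (m + 1) × Fin 2 × Fin 2 =>
      tridiagonalBlock x.1 x.2.1 x.2.2) = ⊤ :=
  (Submodule.span_range_subtype_eq_top_iff _ _).2 span_range_single_blockIndex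

theorem blockEval_tridiagonalBlock_mem_systemV (f : OpDual (tridiagonalSystem (m + 1))) :
    blockEval tridiagonalBlock f ∈ (systemV (m + 1)).toSubmodule := by
  intro k l hkl
  have hindex : blockIndex (m := m) k 1 = blockIndex (m := m) l 0 := Fin.ext hkl.symm
  have hblock : tridiagonalBlock (m := m) k 1 1 = tridiagonalBlock (m := m) l 0 0 :=
    Subtype.ext (by simp only [tridiagonalBlock, Matrix.of_apply, hindex])
  exact congrArg f hblock

theorem exists_chain_of_gram_eq {H ι : Type*} [NormedAddCommGroup H] [InnerProductSpace ℂ H]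
    [FiniteDimensional ℂ H] {c : Fin (m + 1) → Fin 2 → ι → H}
    (h : ∀ k : Fin m, Matrix.gram ℂ (c k.succ 0) = Matrix.gram ℂ (c k.castSucc 1)) :
    ∃ (v : Fin (m + 2) → ι → H) (W : Fin (m + 1) → H ≃ₗᵢ[ℂ] H),
      ∀ k i a, W k (c k i a) = v (blockIndex k i) a := by
  choose A hA using fun k => exists_linearIsometryEquiv_of_gram_eq (h k)
  let W : Fin (m + 1) → H ≃ₗᵢ[ℂ] H :=
    Fin.induction (LinearIsometryEquiv.refl ℂ H) fun k Wk => (A k).trans Wk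
  have hW (k : Fin m) (x : H) : W k.succ x = W k.castSucc (A k x) := rfl
  let v : Fin (m + 2) → ι → H := Fin.cons (W 0 ∘ c 0 0) fun k => W k ∘ c k 1
  refine ⟨v, W, fun k i a => ?_⟩
  fin_cases i
  · cases k using Fin.cases with
    | zero => rfl
    | succ k => exact (hW k _).trans (congrArg _ (hA k a))
  · rfl

theorem gram_succ_eq_of_gramBlocks_mem_systemV {H : Type*} [NormedAddCommGroup H]
    [InnerProductSpace ℂ H] {p : ℕ} {c : Fin (m + 1) → Fin 2 → Fin p → H}
    (hc : ∀ a b, gramBlocks c a b ∈ (systemV (m + 2)).toSubmodule) (k : Fin m) :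
    Matrix.gram ℂ (c k.succ 0) = Matrix.gram ℂ (c k.castSucc 1) := by
  ext a b
  exact (hc a b k.castSucc k.succ rfl).symm

theorem tridiagonalDual_completelyOrderIsomorphic (m : ℕ) :
    CompletelyOrderIsomorphic (OpDual (tridiagonalSystem (m + 2))) (systemV (m + 2)) := by
  refine completelyOrderIsomorphic_of_blockEval tridiagonalBlock_mem_pos
    span_range_tridiagonalBlock blockEval_tridiagonalBlock_mem_systemV fun p c hc => ?_
  obtain ⟨v, W, hvW⟩ := exists_chain_of_gram_eq (gram_succ_eq_of_gramBlocks_mem_systemV hc)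
  refine ⟨_, gramFunctional_mem_pos (tridiagonalSystem (m + 2)) fun a i => v i a, ?_⟩
  ext a b : 1
  funext k
  ext i j
  calc gramFunctional (fun i => v i a) (fun i => v i b) (tridiagonalBlock k i j).1
    _ = inner ℂ (v (blockIndex k i) a) (v (blockIndex k j) b) := gramFunctional_single _ _ _ _
    _ = inner ℂ (c k i a) (c k j b) := by rw [← hvW, ← hvW, LinearIsometryEquiv.inner_map_map]

end Tridiagonal

section Free

/-- The `*`-homomorphism `C*(G) → B(H_π)` induced by a unitary representation `π`: the projection
of the universal representation onto the coordinate `π`. -/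
def evalRep {G : Type} [Group G] (π : UnitaryRep G) : FullGroupCStar G →⋆ₐ[ℂ] π.Op where
  toFun x := x.1.1 π
  map_one' := rfl
  map_mul' _ _ := rfl
  map_zero' := rfl
  map_add' _ _ := rfl
  commutes' _ := rfl
  map_star' _ := rfl

theorem evalRep_groupElem {G : Type} [Group G] (π : UnitaryRep G) (g : G) :
    evalRep π (groupElem g) = π.rep g := rfl

theorem star_groupElem_mul_self {G : Type} [Group G] (g : G) :
    star (groupElem g) * groupElem g = 1 :=
  Subtype.ext (Subtype.ext (funext fun π => Unitary.coe_star_mul_self (π.rep g)))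

variable {m : ℕ}

theorem exists_starAlgHom_universalUnitary_apply {H : Type} [NormedAddCommGroup H]
    [InnerProductSpace ℂ H] [CompleteSpace H] [Nontrivial H] (U : Fin m → H ≃ₗᵢ[ℂ] H) :
    ∃ π : FullGroupCStar (FreeGroup (Fin m)) →⋆ₐ[ℂ] (H →L[ℂ] H),
      ∀ k x, π (universalUnitary m k) x = U k x := by
  let π : UnitaryRep (FreeGroup (Fin m)) :=
    { space := H, rep := FreeGroup.lift fun k => Unitary.linearIsometryEquiv.symm (U k) }
  refine ⟨evalRep π, fun k x => ?_⟩
  have hrep : π.rep (FreeGroup.of k) = Unitary.linearIsometryEquiv.symm (U k) :=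
    FreeGroup.lift_apply_of
  rw [universalUnitary, evalRep_groupElem, hrep]
  rfl

/-- The row `[1, u_k]` over `C*(F_m)`. -/
def freeRow (k : Fin m) : Fin 2 → FullGroupCStar (FreeGroup (Fin m)) :=
  ![1, universalUnitary m k]

theorem star_freeRow_mul_self (k : Fin m) (i : Fin 2) : star (freeRow k i) * freeRow k i = 1 := by
  fin_cases i
  · simp [freeRow]
  · exact star_groupElem_mul_self _

theorem star_freeRow_mul_mem_freeSystem (k : Fin m) (i j : Fin 2) :
    star (freeRow k i) * freeRow k j ∈ (freeSystem m).toSubmodule := by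
  by_cases hij : i = j
  · rw [hij, star_freeRow_mul_self]
    exact (freeSystem m).one_mem'
  · refine Submodule.subset_span ?_
    fin_cases i <;> fin_cases j <;> simp_all [freeRow]

/-- The matrix `[1, u_k; u_k^*, 1]` over `S_m`, written as `xᴴ x` for the row `x = [1, u_k]`. -/
def freeBlock (k : Fin m) : Matrix (Fin 2) (Fin 2) (freeSystem m) :=
  Matrix.of fun i j => ⟨star (freeRow k i) * freeRow k j, star_freeRow_mul_mem_freeSystem k i j⟩

theorem freeBlock_mem_pos (k : Fin m) : freeBlock k ∈ MatrixOrderedSpace.pos 2 :=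
  star_mul_mem_matrixPos (freeRow k)

theorem span_range_star_freeRow_mul :
    Submodule.span ℂ (Set.range fun x : Fin (m + 1) × Fin 2 × Fin 2 =>
      star (freeRow x.1 x.2.1) * freeRow x.1 x.2.2) = (freeSystem (m + 1)).toSubmodule := by
  refine le_antisymm (Submodule.span_le.2 ?_) (Submodule.span_mono ?_)
  · rintro _ ⟨x, rfl⟩
    exact star_freeRow_mul_mem_freeSystem _ _ _
  · rintro _ ((rfl | ⟨k, rfl⟩) | ⟨k, rfl⟩)
    · exact ⟨(0, 0, 0), by simp [freeRow]⟩
    · exact ⟨(k, 0, 1), by simp [freeRow]⟩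
    · exact ⟨(k, 1, 0), by simp [freeRow]⟩

theorem span_range_freeBlock :
    Submodule.span ℂ (Set.range fun x : Fin (m + 1) × Fin 2 × Fin 2 =>
      freeBlock x.1 x.2.1 x.2.2) = ⊤ :=
  (Submodule.span_range_subtype_eq_top_iff _ _).2 span_range_star_freeRow_mul

theorem blockEval_freeBlock_mem_systemU (f : OpDual (freeSystem m)) :
    blockEval freeBlock f ∈ (systemU (m + 1)).toSubmodule := by
  intro k l i j
  have hblock : freeBlock (m := m) k i i = freeBlock (m := m) l j j :=
    Subtype.ext ((star_freeRow_mul_self k i).trans (star_freeRow_mul_self l j).symm)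
  exact congrArg f hblock

theorem exists_pos_map_blockEval_freeBlock_eq {H : Type} [NormedAddCommGroup H]
    [InnerProductSpace ℂ H] [FiniteDimensional ℂ H] [Nontrivial H] {p : ℕ}
    {c : Fin m → Fin 2 → Fin p → H} (v : Fin p → H)
    (hc : ∀ k i, Matrix.gram ℂ v = Matrix.gram ℂ (c k i)) :
    ∃ G ∈ MatrixOrderedSpace.pos p, G.map (blockEval freeBlock) = gramBlocks c := by
  have : CompleteSpace H := FiniteDimensional.complete ℂ H
  choose W hW using fun k i => exists_linearIsometryEquiv_of_gram_eq (hc k i)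
  obtain ⟨π, hπ⟩ := exists_starAlgHom_universalUnitary_apply fun k => (W k 1).trans (W k 0).symm
  have hrow (k i a) : π (freeRow k i) (v a) = (W k 0).symm (c k i a) := by
    fin_cases i <;> simp [freeRow, hπ, ← hW]
  refine ⟨_, vectorFunctional_mem_pos (freeSystem m) π v, ?_⟩
  ext a b : 1
  funext k
  ext i j
  calc vectorFunctional π (v a) (v b) (star (freeRow k i) * freeRow k j)
    _ = inner ℂ (π (freeRow k i) (v a)) (π (freeRow k j) (v b)) :=
      vectorFunctional_star_mul π _ _ _ _
    _ = inner ℂ (c k i a) (c k j b) := by rw [hrow, hrow, LinearIsometryEquiv.inner_map_map]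

theorem gram_eq_of_gramBlocks_mem_systemU {H : Type*} [NormedAddCommGroup H]
    [InnerProductSpace ℂ H] {p : ℕ} {c : Fin m → Fin 2 → Fin p → H}
    (hc : ∀ a b, gramBlocks c a b ∈ (systemU (m + 1)).toSubmodule) (k l : Fin m) (i j : Fin 2) :
    Matrix.gram ℂ (c k i) = Matrix.gram ℂ (c l j) := by
  ext a b
  exact hc a b k l i j

theorem freeDual_completelyOrderIsomorphic (m : ℕ) :
    CompletelyOrderIsomorphic (OpDual (freeSystem (m + 1))) (systemU (m + 2)) := by
  refine completelyOrderIsomorphic_of_blockEval freeBlock_mem_pos span_range_freeBlock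
    blockEval_freeBlock_mem_systemU fun p c hc => ?_
  cases p with
  | zero => exact ⟨0, MatrixOrderedSpace.zero_pos 0, Matrix.ext fun a => a.elim0⟩
  | succ p =>
    exact exists_pos_map_blockEval_freeBlock_eq (c (0 : Fin (m + 1)) 0) fun k i =>
      gram_eq_of_gramBlocks_mem_systemU hc _ k 0 i

end Free

end OpSys

end

theorem mainTheorem9 (n : ℕ) (hn : 2 ≤ n) :
    OpSys.CompletelyOrderIsomorphic
        (OpSys.OpDual (OpSys.tridiagonalSystem n)) (OpSys.systemV n) ∧
      OpSys.CompletelyOrderIsomorphic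
        (OpSys.OpDual (OpSys.freeSystem (n - 1))) (OpSys.systemU n) := by
  obtain ⟨m, rfl⟩ := Nat.exists_eq_add_of_le' hn
  exact ⟨OpSys.tridiagonalDual_completelyOrderIsomorphic m,
    OpSys.freeDual_completelyOrderIsomorphic m⟩
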